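/- Let $k$ be an algebraically closed field (of any characteristic). A \emph{basis set} in $r$ variables is a finite nonempty set $\beta$ of monomials in $x_1,\dots,x_r$ such that every monomial dividing a member of $\beta$ belongs to $\beta$. Put $n=|\beta|$, and let $I_\beta\subseteq k[x_1,\dots,x_r]$ be the ideal generated by the monomials not in $\beta$; it has colength $n$ and so defines a point $t_\beta$ of the Hilbert scheme $\mathbf{H}^n$ of $n$ points of $\mathbb{A}^r_k$. Let $U_\beta\subseteq\mathbf{H}^n$ be the affine open subscheme that parameterizes the ideals $I$ such that $\beta$ is a basis of the quotient $k[x_1,\dots,x_r]/I$. Its coordinate ring $R$ is the $k$-algebra generated by the elements $c^d_j$ ($x^d\notin\beta$, $x^j\in\beta$), subject to the relations $$c^{d+e_i}_{j_0}=\sum_{x^j\in\beta}c^d_j\,c^{j+e_i}_{j_0}\qquad(x^d\notin\beta,\ x^{j_0}\in\beta,\ 1\le i\le r),$$ where $e_i$ is the $i$-th unit vector and $c^b_{j}$ means $1$ if $b=j$ and $0$ if $b\ne j$, whenever $x^b\in\beta$. The maximal ideal $M\subseteq R$ of $t_\beta$ is generated by the $c^d_j$ with $x^d\notin\beta$. The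 basis set $\beta$ is called \emph{smooth} if the cotangent space $M/M^2$ of $\mathbf{H}^n$ at $t_\beta$ satisfies $\dim_k(M/M^2)=rn$; equivalently, if $t_\beta$ is a nonsingular point of $\mathbf{H}^n$. (1) If $\beta_0$ is a smooth basis set in the $r-1$ variables $x_1,\dots,x_{r-1}$ (where $r\ge 1$), then for every integer $w_r>0$ its thickening $$\beta=\{m\cdot x_r^s \mid m\in\beta_0,\ 0\le s<w_r\}$$ is a smooth basis set in the $r$ variables $x_1,\dots,x_r$. (2) For all positive integers $w_1,\dots,w_r$, the box $$\operatorname{Box}(w_1,\dots,w_r)=\{x_1^{d_1}\cdots x_r^{d_r}\mid 0\le d_i<w_i\text{ for }1\le i\le r\}$$ is a smooth basis set in $x_1,\dots,x_r$. -/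

import Mathlib

noncomputable section

namespace HilbertPoints

open MvPolynomial

/-! Monomials in `x_1, ..., x_r` are identified with their exponent vectors
`d : Fin r →₀ ℕ`; divisibility of monomials is then the order `≤`. -/

/-- A basis set: a finite nonempty set of monomials that contains every divisor of each of its
members. -/
def IsBasisSet {r : ℕ} (β : Finset (Fin r →₀ ℕ)) : Prop :=
  β.Nonempty ∧ ∀ m₁ ∈ β, ∀ m₂, m₂ ≤ m₁ → m₂ ∈ β

/-- The monomial ideal `I_β`, generated by the monomials that do not belong to `β`. -/
def monomialIdeal (k : Type*) [Field k] {r : ℕ} (β : Finset (Fin r →₀ ℕ)) :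
    Ideal (MvPolynomial (Fin r) k) :=
  Ideal.span {p | ∃ d, d ∉ β ∧ p = monomial d 1}

/-- Arrows: pairs `(d, j)` with tail `d ∉ β` and head `j ∈ β`. -/
abbrev Arrow {r : ℕ} (β : Finset (Fin r →₀ ℕ)) : Type :=
  {d : Fin r →₀ ℕ // d ∉ β} × {j : Fin r →₀ ℕ // j ∈ β}

/-- The symbol `C^d_j`: an indeterminate if `d ∉ β`, and the constant `δ_{d,j}` if `d ∈ β`. -/
def coeffPoly (k : Type*) [Field k] {r : ℕ} (β : Finset (Fin r →₀ ℕ)) (d : Fin r →₀ ℕ)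
    (j : {j : Fin r →₀ ℕ // j ∈ β}) : MvPolynomial (Arrow β) k :=
  if h : d ∈ β then (if d = j.1 then 1 else 0) else X (⟨d, h⟩, j)

/-- The relation `τ = C^{d'}_{j₀} - ∑_{j ∈ β} C^d_j C^{j'}_{j₀}`, where `d' = d + e_i` and
`j' = j + e_i`. -/
def relation (k : Type*) [Field k] {r : ℕ} (β : Finset (Fin r →₀ ℕ)) (d : Fin r →₀ ℕ) (i : Fin r)
    (j₀ : {j : Fin r →₀ ℕ // j ∈ β}) : MvPolynomial (Arrow β) k :=
  coeffPoly k β (d + Finsupp.single i 1) j₀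
    - ∑ j : {j : Fin r →₀ ℕ // j ∈ β},
        coeffPoly k β d j * coeffPoly k β (j.1 + Finsupp.single i 1) j₀

/-- The ideal generated by all the relations `τ` with `d ∉ β`. -/
def relationIdeal (k : Type*) [Field k] {r : ℕ} (β : Finset (Fin r →₀ ℕ)) :
    Ideal (MvPolynomial (Arrow β) k) :=
  Ideal.span {p | ∃ d, d ∉ β ∧ ∃ i j₀, p = relation k β d i j₀}

/-- The coordinate ring `R` of the affine open subscheme `U_β` of the Hilbert scheme of `n = |β|`
points of affine `r`-space, whose points are the ideals `I` such that `β` is a basis of `k[x]/I`.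
That `R` represents the functor of these ideals is proved in `coordRing_universal`. -/
abbrev CoordRing (k : Type*) [Field k] {r : ℕ} (β : Finset (Fin r →₀ ℕ)) : Type _ :=
  MvPolynomial (Arrow β) k ⧸ relationIdeal k β

/-- The coefficient function `c^d_j` in `R`. -/
def coeffFun (k : Type*) [Field k] {r : ℕ} (β : Finset (Fin r →₀ ℕ)) (d : Fin r →₀ ℕ)
    (j : {j : Fin r →₀ ℕ // j ∈ β}) : CoordRing k β :=
  Ideal.Quotient.mk (relationIdeal k β) (coeffPoly k β d j)

/-- The universal ideal in `R[x]`, generated by the polynomials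
`F_d = x^d - ∑_{j ∈ β} c^d_j x^j`. -/
def universalIdeal (k : Type*) [Field k] {r : ℕ} (β : Finset (Fin r →₀ ℕ)) :
    Ideal (MvPolynomial (Fin r) (CoordRing k β)) :=
  Ideal.span {p | ∃ d, p = monomial d 1
    - ∑ j : {j : Fin r →₀ ℕ // j ∈ β}, monomial j.1 (coeffFun k β d j)}

/-- The maximal ideal `M` of the point `t_β` (the point of the ideal `I_β`) in `R`, generated by
the functions `c^d_j` with `d ∉ β`. See `maximalIdeal_eq_ker`. -/
def maximalIdeal (k : Type*) [Field k] {r : ℕ} (β : Finset (Fin r →₀ ℕ)) :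
    Ideal (CoordRing k β) :=
  Ideal.span {c | ∃ d j, d ∉ β ∧ c = coeffFun k β d j}

/-- `β` is a smooth basis set: `β` is a basis set, and the cotangent space `M / M²` of the point
`t_β` of the Hilbert scheme has `k`-dimension `r n`, where `n = |β|` (the dimension of the
component of the Hilbert scheme that contains the reduced subschemes, on which `t_β` lies);
equivalently, `t_β` is a nonsingular point. -/
def IsSmoothBasisSet (k : Type*) [Field k] {r : ℕ} (β : Finset (Fin r →₀ ℕ)) : Prop :=
  IsBasisSet β ∧ Module.rank k (maximalIdeal k β).Cotangent = ((r * β.card : ℕ) : Cardinal)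

/-- The thickening `{m * x_{r+1}^s | m ∈ β₀, 0 ≤ s < w}` of `β₀` from `r` to `r + 1` variables. -/
def thickening {r : ℕ} (β₀ : Finset (Fin r →₀ ℕ)) (w : ℕ) : Finset (Fin (r + 1) →₀ ℕ) :=
  (β₀ ×ˢ Finset.range w).image fun p =>
    Finsupp.embDomain Fin.castSuccEmb p.1 + Finsupp.single (Fin.last r) p.2

/-- `Box(w_1, ..., w_r)`: the monomials `x^d` with `d_i < w_i` for all `i`. -/
def box {r : ℕ} (w : Fin r → ℕ) : Finset (Fin r →₀ ℕ) :=
  (Fintype.piFinset fun i => Finset.range (w i)).map Finsupp.equivFunOnFinite.symm.toEmbedding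

theorem mem_box {r : ℕ} (w : Fin r → ℕ) (d : Fin r →₀ ℕ) : d ∈ box w ↔ ∀ i, d i < w i := by
  unfold box
  constructor
  · intro h i
    obtain ⟨f, hf, rfl⟩ := Finset.mem_map.1 h
    exact Finset.mem_range.1 (Fintype.mem_piFinset.1 hf i)
  · intro h
    refine Finset.mem_map.2 ⟨fun i => d i, ?_, by ext i; rfl⟩
    exact Fintype.mem_piFinset.2 fun i => Finset.mem_range.2 (h i)

/-! ### Verification that `CoordRing`, `universalIdeal` and `maximalIdeal` are the right objects -/

/-- The ideal `J` of `A[x]` is such that the monomials in `β` are an `A`-basis of `A[x]/J`. -/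
def HasMonomialBasis {A : Type*} [CommRing A] {r : ℕ} (β : Finset (Fin r →₀ ℕ))
    (J : Ideal (MvPolynomial (Fin r) A)) : Prop :=
  ∃ b : Module.Basis {j : Fin r →₀ ℕ // j ∈ β} A (MvPolynomial (Fin r) A ⧸ J),
    ∀ j, b j = Ideal.Quotient.mk J (monomial j.1 1)

section Universal

variable {k : Type*} [Field k] {r : ℕ} {β : Finset (Fin r →₀ ℕ)}

theorem coeffFun_of_mem {d : Fin r →₀ ℕ} (h : d ∈ β) (j : {j : Fin r →₀ ℕ // j ∈ β}) :
    coeffFun k β d j = if d = j.1 then 1 else 0 := by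
  unfold coeffFun coeffPoly
  rw [dif_pos h]
  split_ifs <;> simp

theorem coeffFun_succ (d : Fin r →₀ ℕ) (i : Fin r) (j₀ : {j : Fin r →₀ ℕ // j ∈ β}) :
    coeffFun k β (d + Finsupp.single i 1) j₀
      = ∑ j, coeffFun k β d j * coeffFun k β (j.1 + Finsupp.single i 1) j₀ := by
  by_cases h : d ∈ β
  · rw [Finset.sum_eq_single ⟨d, h⟩]
    · simp [coeffFun_of_mem h]
    · intro j _ hj
      rw [coeffFun_of_mem h, if_neg, zero_mul]
      rintro rfl
      exact hj rfl
    · simp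
  · have : relation k β d i j₀ ∈ relationIdeal k β :=
      Ideal.subset_span ⟨d, h, i, j₀, rfl⟩
    have := Ideal.Quotient.eq_zero_iff_mem.2 this
    rw [relation, map_sub, sub_eq_zero, map_sum] at this
    simpa only [coeffFun, map_mul] using this

/-- For a hom `φ : R → A`, the linear map `A[x] → A^β` with `x^d ↦ (φ (c^d_j))_j`. -/
def normalForm {A : Type*} [CommRing A] [Algebra k A] (φ : CoordRing k β →ₐ[k] A) :
    MvPolynomial (Fin r) A →ₗ[A] ({j : Fin r →₀ ℕ // j ∈ β} → A) :=
  (basisMonomials (Fin r) A).constr A fun d j => φ (coeffFun k β d j)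

theorem normalForm_monomial {A : Type*} [CommRing A] [Algebra k A] (φ : CoordRing k β →ₐ[k] A)
    (d : Fin r →₀ ℕ) (a : A) :
    normalForm φ (monomial d a) = fun j => a * φ (coeffFun k β d j) := by
  have h1 : (monomial d a : MvPolynomial (Fin r) A) = a • basisMonomials (Fin r) A d := by
    simp [coe_basisMonomials, smul_monomial]
  rw [h1, map_smul, normalForm, Module.Basis.constr_basis]
  rfl

theorem normalForm_X_mul {A : Type*} [CommRing A] [Algebra k A] (φ : CoordRing k β →ₐ[k] A)
    (i : Fin r) (p : MvPolynomial (Fin r) A) (j₀ : {j : Fin r →₀ ℕ // j ∈ β}) :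
    normalForm φ (X i * p) j₀
      = ∑ j, normalForm φ p j * φ (coeffFun k β (j.1 + Finsupp.single i 1) j₀) := by
  induction p using MvPolynomial.induction_on' with
  | monomial d a =>
    rw [mul_comm, X, monomial_mul, mul_one, normalForm_monomial, normalForm_monomial]
    simp only [coeffFun_succ d, map_sum, map_mul, Finset.mul_sum, mul_assoc]
  | add p q hp hq =>
    rw [mul_add, map_add, map_add, Pi.add_apply, hp, hq, ← Finset.sum_add_distrib]
    simp [add_mul]

theorem normalForm_mul_eq_zero {A : Type*} [CommRing A] [Algebra k A] (φ : CoordRing k β →ₐ[k] A)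
    (q p : MvPolynomial (Fin r) A) (hp : normalForm φ p = 0) : normalForm φ (q * p) = 0 := by
  induction q using MvPolynomial.induction_on with
  | C a => rw [← smul_eq_C_mul, map_smul, hp, smul_zero]
  | add q q' h h' => rw [add_mul, map_add, h, h', add_zero]
  | mul_X q i h =>
    rw [mul_comm q, mul_assoc]
    funext j₀
    rw [normalForm_X_mul, h]
    simp

theorem normalForm_of_mem {A : Type*} [CommRing A] [Algebra k A] (φ : CoordRing k β →ₐ[k] A)
    (j : {j : Fin r →₀ ℕ // j ∈ β}) (a : A) :
    normalForm φ (monomial j.1 a) = Pi.single j a := by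
  rw [normalForm_monomial]
  funext j'
  rw [coeffFun_of_mem j.2]
  by_cases h : j = j'
  · subst h; simp
  · have h' : j.1 ≠ j'.1 := fun e => h (Subtype.ext e)
    simp [h', Pi.single_eq_of_ne' h]

/-- The fibre of the universal ideal over `φ : R → A`. -/
theorem mem_map_universalIdeal {A : Type*} [CommRing A] [Algebra k A] (φ : CoordRing k β →ₐ[k] A)
    (p : MvPolynomial (Fin r) A) :
    p ∈ (universalIdeal k β).map (MvPolynomial.map φ.toRingHom) ↔ normalForm φ p = 0 := by
  have key : ∀ d : Fin r →₀ ℕ, monomial d 1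
      - ∑ j : {j : Fin r →₀ ℕ // j ∈ β}, monomial j.1 (φ (coeffFun k β d j))
      ∈ (universalIdeal k β).map (MvPolynomial.map φ.toRingHom) := by
    intro d
    have := Ideal.mem_map_of_mem (MvPolynomial.map φ.toRingHom)
      (Ideal.subset_span ⟨d, rfl⟩ : _ ∈ universalIdeal k β)
    rw [map_sub, map_sum] at this
    simp only [map_monomial, map_one] at this
    exact this
  constructor
  · intro hp
    rw [universalIdeal, Ideal.map_span] at hp
    refine Submodule.span_induction ?_ (map_zero _) ?_ ?_ hp
    · rintro _ ⟨_, ⟨d, rfl⟩, rfl⟩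
      simp only [map_sub, map_sum, map_monomial, normalForm_of_mem]
      rw [map_one, normalForm_monomial]
      funext j₀
      simp [Finset.sum_apply, Pi.single_apply]
    · intro x y _ _ hx hy
      rw [map_add, hx, hy, add_zero]
    · intro a x _ hx
      exact normalForm_mul_eq_zero φ a x hx
  · intro hp
    have hred : ∀ q : MvPolynomial (Fin r) A,
        q - ∑ j : {j : Fin r →₀ ℕ // j ∈ β}, monomial j.1 (normalForm φ q j)
          ∈ (universalIdeal k β).map (MvPolynomial.map φ.toRingHom) := by
      intro q
      induction q using MvPolynomial.induction_on' with
      | monomial d a =>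
        have := Ideal.mul_mem_left _ (C a) (key d)
        rw [mul_sub, Finset.mul_sum] at this
        simpa [C_mul_monomial, normalForm_monomial] using this
      | add q q' h h' =>
        have := Ideal.add_mem _ h h'
        convert this using 1
        simp only [map_add, Pi.add_apply, Finset.sum_add_distrib]
        ring
    have := hred p
    rw [hp] at this
    simpa using this

theorem hasMonomialBasis_map {A : Type*} [CommRing A] [Algebra k A] (φ : CoordRing k β →ₐ[k] A) :
    HasMonomialBasis β ((universalIdeal k β).map (MvPolynomial.map φ.toRingHom)) := by
  set J := (universalIdeal k β).map (MvPolynomial.map φ.toRingHom) with hJ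
  have hker : LinearMap.ker (normalForm φ) = J.restrictScalars A := by
    ext p
    rw [LinearMap.mem_ker, Submodule.restrictScalars_mem, hJ, mem_map_universalIdeal]
  have hsurj : Function.Surjective (normalForm φ) := by
    intro v
    refine ⟨∑ j, monomial j.1 (v j), ?_⟩
    rw [map_sum]
    simp only [normalForm_of_mem]
    exact Finset.univ_sum_single v
  let e₁ := (normalForm φ).quotKerEquivOfSurjective hsurj
  let e₂ : (MvPolynomial (Fin r) A ⧸ J) ≃ₗ[A] (MvPolynomial (Fin r) A ⧸ LinearMap.ker (normalForm φ)) :=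
    (Submodule.Quotient.restrictScalarsEquiv A J).symm.trans
      (Submodule.quotEquivOfEq _ _ hker.symm)
  refine ⟨Module.Basis.ofEquivFun (e₂.trans e₁), fun j => ?_⟩
  rw [Module.Basis.coe_ofEquivFun]
  rw [LinearEquiv.symm_apply_eq]
  exact (normalForm_of_mem φ j 1).symm

/-- Universal property: `R` represents the functor that takes a `k`-algebra `A` to the set of the
ideals `J` of `A[x]` such that the monomials in `β` are an `A`-basis of `A[x]/J`. -/
theorem coordRing_universal (A : Type*) [CommRing A] [Algebra k A] :
    Set.BijOn (fun φ : CoordRing k β →ₐ[k] A =>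
        (universalIdeal k β).map (MvPolynomial.map φ.toRingHom))
      Set.univ {J | HasMonomialBasis β J} := by
  refine ⟨fun φ _ => hasMonomialBasis_map φ, ?_, ?_⟩
  · intro φ _ ψ _ h
    have h : (universalIdeal k β).map (MvPolynomial.map φ.toRingHom)
      = (universalIdeal k β).map (MvPolynomial.map ψ.toRingHom) := h
    have hc : ∀ d j, φ (coeffFun k β d j) = ψ (coeffFun k β d j) := by
      intro d j
      have h1 : (monomial d 1 - ∑ j : {j : Fin r →₀ ℕ // j ∈ β}, monomial j.1 (φ (coeffFun k β d j))
          : MvPolynomial (Fin r) A)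
          ∈ (universalIdeal k β).map (MvPolynomial.map φ.toRingHom) := by
        rw [mem_map_universalIdeal]
        simp only [map_sub, map_sum, normalForm_of_mem]
        rw [normalForm_monomial]
        funext j₀
        simp [Finset.sum_apply, Pi.single_apply]
      rw [h, mem_map_universalIdeal] at h1
      simp only [map_sub, map_sum, normalForm_of_mem] at h1
      rw [normalForm_monomial] at h1
      have := congrFun h1 j
      simp [Finset.sum_apply, Pi.single_apply] at this
      exact (sub_eq_zero.1 this).symm
    refine Ideal.Quotient.algHom_ext _ (MvPolynomial.algHom_ext fun a => ?_)
    have := hc a.1.1 a.2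
    rw [coeffFun, coeffPoly, dif_neg a.1.2] at this
    exact this
  · rintro J ⟨b, hb⟩
    let c : (Fin r →₀ ℕ) → {j : Fin r →₀ ℕ // j ∈ β} → A := fun d j =>
      b.repr (Ideal.Quotient.mk J (monomial d 1)) j
    have hc1 : ∀ d (h : d ∈ β) j, c d j = if d = j.1 then 1 else 0 := by
      intro d h j
      have : c d j = b.repr (b ⟨d, h⟩) j := by rw [hb]
      rw [this, Module.Basis.repr_self, Finsupp.single_apply]
      simp [Subtype.ext_iff]
    have hsum : ∀ d, Ideal.Quotient.mk J (monomial d 1)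
        = ∑ j, c d j • Ideal.Quotient.mk J (monomial j.1 (1 : A)) := by
      intro d
      conv_lhs => rw [← b.sum_repr (Ideal.Quotient.mk J (monomial d 1))]
      simp only [hb]
      rfl
    have hc2 : ∀ d i j₀, c (d + Finsupp.single i 1) j₀
        = ∑ j, c d j * c (j.1 + Finsupp.single i 1) j₀ := by
      intro d i j₀
      have hm : ∀ d : Fin r →₀ ℕ, Ideal.Quotient.mk J (monomial (d + Finsupp.single i 1) (1 : A))
          = Ideal.Quotient.mk J (X i) * Ideal.Quotient.mk J (monomial d 1) := by
        intro d
        rw [← map_mul, mul_comm, X, monomial_mul, one_mul]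
      have : Ideal.Quotient.mk J (monomial (d + Finsupp.single i 1) (1 : A))
          = ∑ j, c d j • Ideal.Quotient.mk J (monomial (j.1 + Finsupp.single i 1) (1 : A)) := by
        rw [hm, hsum d, Finset.mul_sum]
        refine Finset.sum_congr rfl fun j _ => ?_
        rw [hm, mul_smul_comm]
      have := congrArg (fun v => b.repr v j₀) this
      simpa [c, Finsupp.finsetSum_apply] using this
    let f : MvPolynomial (Arrow β) k →ₐ[k] A := aeval fun a => c a.1.1 a.2
    have hf : ∀ d j, f (coeffPoly k β d j) = c d j := by
      intro d j
      unfold coeffPoly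
      split_ifs with h h'
      · rw [map_one, hc1 d h, if_pos h']
      · rw [map_zero, hc1 d h, if_neg h']
      · simp [f]
    have hrel : ∀ a ∈ relationIdeal k β, f a = 0 := by
      intro a ha
      refine (Ideal.span_le (I := RingHom.ker f)).2 ?_ ha
      rintro _ ⟨d, _, i, j₀, rfl⟩
      change f _ = 0
      rw [relation, map_sub, map_sum]
      simp only [map_mul, hf]
      rw [hc2, sub_self]
    let φ : CoordRing k β →ₐ[k] A := Ideal.Quotient.liftₐ _ f hrel
    have hφ : ∀ d j, φ (coeffFun k β d j) = c d j := fun d j => hf d j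
    refine ⟨φ, trivial, ?_⟩
    ext p
    change p ∈ (universalIdeal k β).map (MvPolynomial.map φ.toRingHom) ↔ _
    rw [mem_map_universalIdeal, ← Ideal.Quotient.eq_zero_iff_mem]
    have hn : ∀ p, normalForm φ p = b.equivFun (Ideal.Quotient.mk J p) := by
      intro p
      induction p using MvPolynomial.induction_on' with
      | monomial d a =>
        have h1 : (monomial d a : MvPolynomial (Fin r) A) = a • monomial d 1 := by
          simp [smul_monomial]
        have h2 : Ideal.Quotient.mk J (a • monomial d (1 : A))
            = a • Ideal.Quotient.mk J (monomial d (1 : A)) := rfl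
        rw [normalForm_monomial, h1, h2, map_smul]
        funext j
        rw [hφ]
        rfl
      | add p q hp hq => rw [map_add, map_add, map_add, hp, hq]
    rw [hn, LinearEquiv.map_eq_zero_iff]

/-- If `β` is a basis set, then all the `c^d_j` with `d ∉ β` vanish at some `k`-point of `R`; the
ideal `M` is the kernel of that point, and the ideal of `k[x]` that corresponds to the point
is `I_β`. -/
theorem maximalIdeal_eq_ker (hβ : IsBasisSet β) :
    ∃ φ : CoordRing k β →ₐ[k] k, maximalIdeal k β = RingHom.ker φ ∧
      (universalIdeal k β).map (MvPolynomial.map φ.toRingHom) = monomialIdeal k β := by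
  let f : MvPolynomial (Arrow β) k →ₐ[k] k := aeval fun _ => 0
  have hf : ∀ d j, d ∉ β → f (coeffPoly k β d j) = 0 := by
    intro d j h
    rw [coeffPoly, dif_neg h]
    simp [f]
  have hrel : ∀ a ∈ relationIdeal k β, f a = 0 := by
    intro a ha
    refine (Ideal.span_le (I := RingHom.ker f)).2 ?_ ha
    rintro _ ⟨d, hd, i, j₀, rfl⟩
    change f _ = 0
    rw [relation, map_sub, map_sum, hf _ _ fun h => hd (hβ.2 _ h _ le_self_add)]
    simp [hf d _ hd]
  let φ : CoordRing k β →ₐ[k] k := Ideal.Quotient.liftₐ _ f hrel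
  have hφ : ∀ d j, d ∉ β → φ (coeffFun k β d j) = 0 := fun d j h => hf d j h
  have hle : maximalIdeal k β ≤ RingHom.ker φ := by
    refine Ideal.span_le.2 ?_
    rintro _ ⟨d, j, hd, rfl⟩
    exact hφ d j hd
  refine ⟨φ, le_antisymm hle ?_, ?_⟩
  · have hred : ∀ a : MvPolynomial (Arrow β) k,
        Ideal.Quotient.mk (relationIdeal k β) a
          - algebraMap k (CoordRing k β) (f a) ∈ maximalIdeal k β := by
      intro a
      induction a using MvPolynomial.induction_on with
      | C a =>
        have : f (C a) = a := by simp [f]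
        rw [this]
        have : Ideal.Quotient.mk (relationIdeal k β) (C a)
          = algebraMap k (CoordRing k β) a := rfl
        rw [this, sub_self]
        exact Ideal.zero_mem _
      | add p q hp hq =>
        have := Ideal.add_mem _ hp hq
        rw [map_add, map_add, map_add]
        convert this using 1
        ring
      | mul_X p a _ =>
        have h0 : f (X a) = 0 := by simp [f]
        rw [map_mul, map_mul, h0, mul_zero, map_zero, sub_zero]
        refine Ideal.mul_mem_left _ _ (Ideal.subset_span ⟨a.1.1, a.2, a.1.2, ?_⟩)
        rw [coeffFun, coeffPoly, dif_neg a.1.2]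
    intro x hx
    obtain ⟨a, rfl⟩ := Ideal.Quotient.mk_surjective x
    have h0 : f a = 0 := hx
    simpa [h0] using hred a
  · refine le_antisymm ?_ ?_
    · rw [universalIdeal, Ideal.map_span, Ideal.span_le]
      rintro _ ⟨_, ⟨d, rfl⟩, rfl⟩
      simp only [map_sub, map_sum, map_monomial]
      by_cases hd : d ∈ β
      · rw [Finset.sum_eq_single ⟨d, hd⟩]
        · simp [coeffFun_of_mem hd]
        · intro j _ hj
          rw [coeffFun_of_mem hd, if_neg, map_zero, monomial_zero]
          rintro rfl
          exact hj rfl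
        · simp
      · have : ∀ j, φ.toRingHom (coeffFun k β d j) = 0 := fun j => hφ d j hd
        simp only [this, monomial_zero, Finset.sum_const_zero, sub_zero, map_one]
        exact Ideal.subset_span ⟨d, hd, rfl⟩
    · refine Ideal.span_le.2 ?_
      rintro _ ⟨d, hd, rfl⟩
      rw [SetLike.mem_coe, mem_map_universalIdeal, normalForm_monomial]
      funext j
      simp [hφ d j hd]

end Universal

end HilbertPoints

end

/-! The dual of the cotangent space is computed combinatorially. Modulo `M²` the quadratic relations
become linear: the class of `c^d_j` is unchanged when the arrow `(d, j)` is translated by `e_i`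
(tail outside `β`, head inside), and the class of `c^{d+e_i}_j` vanishes when `d ∉ β` and `j i = 0`.
Conversely, a function on arrows with these two properties defines a point of `R` over the dual
numbers, hence a linear form on `M/M²`. So smoothness means that the space of such functions has
dimension `r n` (`dualCotangentEquiv`, `isSmoothBasisSet_iff_rank_tangentSpace`).

For a thickening of `β₀` by `w`, write exponents as `(d, s)`. An arrow from `(d, s)` to `(j, t)` can
be translated back until its head meets a coordinate hyperplane, where the value is forced to be
zero, or its tail reaches a standard position: `(d, 0)` with `d ∉ β₀`, or `(0, w)`. The values at
the first kind of tail form one tangent vector of `β₀` for each height `u < w` of the head; those at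
the second kind are arbitrary scalars, one for each monomial of the thickening
(`tangentSpaceThickeningEquiv`). With `n₀ = |β₀|` the dimension is `w (r n₀) + n₀ w = (r + 1) n₀ w`,
as smoothness requires. A box is an iterated thickening of the basis set in no variables. -/

namespace HilbertPoints

open MvPolynomial

/-! ### The cotangent space at `t_β` and its dual, in terms of arrows -/

section TangentSpace

variable {k : Type*} [Field k] {r : ℕ} {β : Finset (Fin r →₀ ℕ)}

/-- The tangent space at `t_β`, as a space of functions on arrows (extended by zero) that are
invariant under translation and vanish on the arrows whose head can be pushed across a coordinate
hyperplane. -/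
def tangentSpace (k : Type*) [Field k] {r : ℕ} (β : Finset (Fin r →₀ ℕ)) :
    Submodule k ((Fin r →₀ ℕ) → (Fin r →₀ ℕ) → k) where
  carrier := {F | (∀ d j, d ∈ β ∨ j ∉ β → F d j = 0) ∧
    (∀ d i j, d ∉ β → j + Finsupp.single i 1 ∈ β →
      F (d + Finsupp.single i 1) (j + Finsupp.single i 1) = F d j) ∧
    (∀ d i j, d ∉ β → j i = 0 → F (d + Finsupp.single i 1) j = 0)}
  zero_mem' := by simp
  add_mem' := by
    rintro F G ⟨hF, hF', hF''⟩ ⟨hG, hG', hG''⟩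
    refine ⟨fun d j h => ?_, fun d i j h h' => ?_, fun d i j h h' => ?_⟩
    · simp [hF d j h, hG d j h]
    · simp [hF' d i j h h', hG' d i j h h']
    · simp [hF'' d i j h h', hG'' d i j h h']
  smul_mem' := by
    rintro c F ⟨hF, hF', hF''⟩
    refine ⟨fun d j h => ?_, fun d i j h h' => ?_, fun d i j h h' => ?_⟩
    · simp [hF d j h]
    · simp [hF' d i j h h']
    · simp [hF'' d i j h h']

theorem coeffFun_mem_maximalIdeal {d : Fin r →₀ ℕ} (h : d ∉ β)
    (j : {j : Fin r →₀ ℕ // j ∈ β}) : coeffFun k β d j ∈ maximalIdeal k β :=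
  Ideal.subset_span ⟨d, j, h, rfl⟩

/-- Supplies the constant terms at `t_β` of the second factors in the relations, whose exponents may
lie inside or outside `β`. -/
theorem coeffFun_sub_mem_maximalIdeal (d : Fin r →₀ ℕ) (j : {j : Fin r →₀ ℕ // j ∈ β}) :
    coeffFun k β d j - (if d = j.1 then 1 else 0) ∈ maximalIdeal k β := by
  by_cases h : d ∈ β
  · rw [coeffFun_of_mem h, sub_self]
    exact Ideal.zero_mem _
  · rw [if_neg (fun e : d = j.1 => h (e ▸ j.2)), sub_zero]
    exact coeffFun_mem_maximalIdeal h j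

open Classical in
/-- The class of `c^d_j` in the cotangent space (zero unless `(d, j)` is an arrow). -/
noncomputable def cotangentClass (k : Type*) [Field k] {r : ℕ} (β : Finset (Fin r →₀ ℕ)) (d j : Fin r →₀ ℕ) :
    (maximalIdeal k β).Cotangent :=
  if h : d ∉ β ∧ j ∈ β then
    (maximalIdeal k β).toCotangent ⟨coeffFun k β d ⟨j, h.2⟩, coeffFun_mem_maximalIdeal h.1 _⟩
  else 0

theorem cotangentClass_of_arrow {d j : Fin r →₀ ℕ} (hd : d ∉ β) (hj : j ∈ β) :
    cotangentClass k β d j =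
      (maximalIdeal k β).toCotangent ⟨coeffFun k β d ⟨j, hj⟩, coeffFun_mem_maximalIdeal hd _⟩ :=
  dif_pos ⟨hd, hj⟩

theorem cotangentClass_eq_zero {d j : Fin r →₀ ℕ} (h : d ∈ β ∨ j ∉ β) :
    cotangentClass k β d j = 0 :=
  dif_neg (by tauto)

/-- In the relation for `c^{d+e_i}_{j+e_i}` every first factor lies in `M`, so modulo `M²` only the
constant terms of the second factors count, and these select the single summand `j' = j`. -/
theorem cotangentClass_translate (hβ : IsBasisSet β) {d : Fin r →₀ ℕ} {i : Fin r}
    {j : Fin r →₀ ℕ} (hd : d ∉ β) (hj : j + Finsupp.single i 1 ∈ β) :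
    cotangentClass k β (d + Finsupp.single i 1) (j + Finsupp.single i 1)
      = cotangentClass k β d j := by
  have hj' : j ∈ β := hβ.2 _ hj _ le_self_add
  have hd' : d + Finsupp.single i 1 ∉ β := fun h => hd (hβ.2 _ h _ le_self_add)
  rw [cotangentClass_of_arrow hd hj', cotangentClass_of_arrow hd' hj, Ideal.toCotangent_eq]
  have h1 : coeffFun k β d ⟨j, hj'⟩ = ∑ j' : {j : Fin r →₀ ℕ // j ∈ β}, coeffFun k β d j' *
      (if j'.1 + Finsupp.single i 1 = j + Finsupp.single i 1 then 1 else 0) := by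
    rw [Finset.sum_eq_single ⟨j, hj'⟩]
    · simp
    · intro j' _ hne
      rw [if_neg, mul_zero]
      intro e
      exact hne (Subtype.ext (add_right_cancel e))
    · simp
  dsimp only
  rw [coeffFun_succ, h1, ← Finset.sum_sub_distrib, pow_two]
  refine Ideal.sum_mem _ fun j' _ => ?_
  rw [← mul_sub]
  exact Ideal.mul_mem_mul (coeffFun_mem_maximalIdeal hd _)
    (coeffFun_sub_mem_maximalIdeal (j'.1 + Finsupp.single i 1) ⟨_, hj⟩)

/-- Here no `j' + e_i` can equal `j`, so both factors of every summand of the relation lie in `M`.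
-/
theorem cotangentClass_eq_zero_of_apply_eq_zero (hβ : IsBasisSet β) {d : Fin r →₀ ℕ} {i : Fin r}
    {j : Fin r →₀ ℕ} (hd : d ∉ β) (hj : j i = 0) :
    cotangentClass k β (d + Finsupp.single i 1) j = 0 := by
  by_cases hjβ : j ∈ β
  swap
  · exact cotangentClass_eq_zero (Or.inr hjβ)
  have hd' : d + Finsupp.single i 1 ∉ β := fun h => hd (hβ.2 _ h _ le_self_add)
  rw [cotangentClass_of_arrow hd' hjβ, Ideal.toCotangent_eq_zero]
  dsimp only
  rw [coeffFun_succ, pow_two]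
  refine Ideal.sum_mem _ fun j' _ => ?_
  refine Ideal.mul_mem_mul (coeffFun_mem_maximalIdeal hd _) ?_
  have h := coeffFun_sub_mem_maximalIdeal (k := k) (j'.1 + Finsupp.single i 1) ⟨j, hjβ⟩
  rw [if_neg, sub_zero] at h
  · exact h
  · intro e
    have := DFunLike.congr_fun e i
    simp [hj] at this

/-- The `c^d_j` generate `M` over `R`, and `R` acts on `M/M²` through its residue field `k`; hence
their classes span `M/M²` over `k`. -/
theorem cotangent_linearMap_eq_zero (hβ : IsBasisSet β)
    (l : (maximalIdeal k β).Cotangent →ₗ[k] k)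
    (h : ∀ d j, l (cotangentClass k β d j) = 0) : l = 0 := by
  obtain ⟨φ, hφ, -⟩ := maximalIdeal_eq_ker (k := k) hβ
  have smul_cotangent : ∀ (c : k) (m : (maximalIdeal k β).Cotangent),
      algebraMap k (CoordRing k β) c • m = c • m := by
    intro c m
    obtain ⟨m, rfl⟩ := Ideal.toCotangent_surjective _ m
    rw [← map_smul, algebraMap_smul]
    rfl
  have key : ∀ x (hx : x ∈ maximalIdeal k β), l ((maximalIdeal k β).toCotangent ⟨x, hx⟩) = 0 := by
    intro x hx
    refine Submodule.span_induction
      (p := fun x hx => l ((maximalIdeal k β).toCotangent ⟨x, hx⟩) = 0) ?_ ?_ ?_ ?_ hx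
    · rintro _ ⟨d, j, hd, rfl⟩
      have := h d j.1
      rwa [cotangentClass_of_arrow hd j.2] at this
    · exact (congrArg l (map_zero (maximalIdeal k β).toCotangent)).trans (map_zero l)
    · intro x y hx hy hx0 hy0
      have : (⟨x + y, Ideal.add_mem _ hx hy⟩ : maximalIdeal k β) = ⟨x, hx⟩ + ⟨y, hy⟩ := rfl
      rw [this, map_add, map_add, hx0, hy0, add_zero]
    · intro a x hx hx0
      -- Modulo `M`, the coefficient `a` may be replaced by its value `φ a` at the point `t_β`.
      have h1 : a - algebraMap k _ (φ a) ∈ maximalIdeal k β := by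
        rw [hφ, RingHom.mem_ker, map_sub, AlgHom.commutes]
        exact sub_self _
      have h2 : (maximalIdeal k β).toCotangent ⟨a • x, Submodule.smul_mem _ a hx⟩
          = (maximalIdeal k β).toCotangent (algebraMap k (CoordRing k β) (φ a) • ⟨x, hx⟩) := by
        rw [Ideal.toCotangent_eq, pow_two]
        change a * x - algebraMap k (CoordRing k β) (φ a) * x ∈ _
        rw [← sub_mul]
        exact Ideal.mul_mem_mul h1 hx
      rw [h2, map_smul, smul_cotangent, map_smul, hx0, smul_zero]
  ext x
  obtain ⟨⟨x, hx⟩, rfl⟩ := Ideal.toCotangent_surjective _ x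
  exact key x hx

/-- The point of `R` with values in the dual numbers defined by a tangent vector. -/
theorem exists_algHom_dualNumber (hβ : IsBasisSet β)
    {F : (Fin r →₀ ℕ) → (Fin r →₀ ℕ) → k}
    (hF : F ∈ tangentSpace k β) :
    ∃ φ : CoordRing k β →ₐ[k] DualNumber k, ∀ d j, φ (coeffFun k β d j)
      = TrivSqZeroExt.inl (if d = j.1 then 1 else 0) + TrivSqZeroExt.inr (F d j) := by
  obtain ⟨hF, hF', hF''⟩ := hF
  let f : MvPolynomial (Arrow β) k →ₐ[k] DualNumber k :=
    aeval fun a => TrivSqZeroExt.inr (F a.1.1 a.2.1)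
  have hf : ∀ d j, f (coeffPoly k β d j)
      = TrivSqZeroExt.inl (if d = j.1 then 1 else 0) + TrivSqZeroExt.inr (F d j) := by
    intro d j
    unfold coeffPoly
    by_cases h : d ∈ β
    · rw [dif_pos h, hF d j (Or.inl h)]
      split_ifs <;> simp
    · rw [dif_neg h, if_neg (fun e : d = j.1 => h (e ▸ j.2))]
      simp [f]
  have hf' : ∀ d j, d ∉ β → f (coeffPoly k β d j) = TrivSqZeroExt.inr (F d j) := by
    intro d j h
    rw [hf, if_neg (fun e : d = j.1 => h (e ▸ j.2)), TrivSqZeroExt.inl_zero, zero_add]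
  refine ⟨Ideal.Quotient.liftₐ _ f fun a ha => ?_, hf⟩
  refine (Ideal.span_le (I := RingHom.ker f)).2 ?_ ha
  rintro _ ⟨d, hd, i, j₀, rfl⟩
  change f _ = 0
  rw [relation, map_sub, map_sum, sub_eq_zero]
  -- Since `d ∉ β`, the first factor is a multiple of `ε`; as `ε² = 0`, only the constant part of
  -- the second survives.
  have hterm : ∀ j : {j : Fin r →₀ ℕ // j ∈ β}, f (coeffPoly k β d j *
      coeffPoly k β (j.1 + Finsupp.single i 1) j₀) =
      if j.1 + Finsupp.single i 1 = j₀.1 then TrivSqZeroExt.inr (F d j) else 0 := by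
    intro j
    rw [map_mul, hf' d j hd, hf, mul_add, TrivSqZeroExt.inr_mul_inr, add_zero]
    split_ifs <;> simp
  rw [hf' _ _ fun h => hd (hβ.2 _ h _ le_self_add), Finset.sum_congr rfl fun j _ => hterm j]
  by_cases hi : j₀.1 i = 0
  · rw [hF'' d i j₀ hd hi, TrivSqZeroExt.inr_zero, Finset.sum_eq_zero]
    refine fun j _ => if_neg fun e => ?_
    have := DFunLike.congr_fun e i
    simp [hi] at this
  · obtain ⟨j₁, hj₁⟩ : ∃ j₁, j₀.1 = j₁ + Finsupp.single i 1 :=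
      ⟨j₀.1 - Finsupp.single i 1, (tsub_add_cancel_of_le
        (Finsupp.single_le_iff.2 (Nat.one_le_iff_ne_zero.2 hi))).symm⟩
    have hj₁' : j₁ + Finsupp.single i 1 ∈ β := hj₁ ▸ j₀.2
    rw [hj₁, hF' d i j₁ hd hj₁', Finset.sum_eq_single ⟨j₁, hβ.2 _ hj₁' _ le_self_add⟩]
    · simp
    · exact fun j _ hne => if_neg fun e => hne (Subtype.ext (add_right_cancel e))
    · simp

/-- The dual-number point sends `M` into the multiples of `ε`, so it kills products of two elements
of `M`, and its `ε`-component descends to `M/M²`. -/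
theorem exists_linearMap_cotangent {F : (Fin r →₀ ℕ) → (Fin r →₀ ℕ) → k}
    (hβ : IsBasisSet β) (hF : F ∈ tangentSpace k β) :
    ∃ l : (maximalIdeal k β).Cotangent →ₗ[k] k, ∀ d j, l (cotangentClass k β d j) = F d j := by
  obtain ⟨φ, hφ⟩ := exists_algHom_dualNumber hβ hF
  have hfst : ∀ x ∈ maximalIdeal k β, (φ x).fst = 0 := by
    intro x hx
    refine (Ideal.span_le (I := RingHom.ker ((TrivSqZeroExt.fstHom k k k).comp φ))).2 ?_ hx
    rintro _ ⟨d, j, hd, rfl⟩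
    change (φ _).fst = 0
    rw [hφ, if_neg (fun e : d = j.1 => hd (e ▸ j.2))]
    simp
  let f : maximalIdeal k β →ₗ[k] k :=
    ((TrivSqZeroExt.sndHom k k).comp φ.toLinearMap).comp
      ((maximalIdeal k β).subtype.restrictScalars k)
  refine ⟨Ideal.Cotangent.lift f ?_, fun d j => ?_⟩
  · intro x y
    change (φ (x.1 * y.1)).snd = 0
    rw [map_mul, TrivSqZeroExt.snd_mul, hfst _ x.2, hfst _ y.2]
    simp
  · by_cases h : d ∉ β ∧ j ∈ β
    · rw [cotangentClass_of_arrow h.1 h.2, Ideal.Cotangent.lift_toCotangent]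
      change (φ (coeffFun k β d ⟨j, h.2⟩)).snd = _
      rw [hφ]
      simp
    · rw [cotangentClass_eq_zero (by tauto), map_zero, hF.1 d j (by tauto)]

/-- The dual of the cotangent space is the tangent space. -/
noncomputable def dualCotangentEquiv (k : Type*) [Field k] (hβ : IsBasisSet β) :
    Module.Dual k (maximalIdeal k β).Cotangent ≃ₗ[k] tangentSpace k β :=
  LinearEquiv.ofBijective
    ({ toFun := fun l => ⟨fun d j => l (cotangentClass k β d j), by
          refine ⟨fun d j h => ?_, fun d i j h h' => ?_, fun d i j h h' => ?_⟩
          · simp only [cotangentClass_eq_zero h, map_zero]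
          · simp only [cotangentClass_translate hβ h h']
          · simp only [cotangentClass_eq_zero_of_apply_eq_zero hβ h h', map_zero]⟩
       map_add' := fun _ _ => rfl
       map_smul' := fun _ _ => rfl } :
      Module.Dual k (maximalIdeal k β).Cotangent →ₗ[k] tangentSpace k β)
    ⟨by
      rw [← LinearMap.ker_eq_bot, LinearMap.ker_eq_bot']
      intro l hl
      exact cotangent_linearMap_eq_zero hβ l fun d j =>
        congrFun (congrFun (congrArg Subtype.val hl) d) j,
    by
      rintro ⟨F, hF⟩
      obtain ⟨l, hl⟩ := exists_linearMap_cotangent hβ hF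
      exact ⟨l, Subtype.ext (funext fun d => funext fun j => hl d j)⟩⟩

/-- Finite dimension is not assumed: a finite rank on either side makes both spaces
finite-dimensional. -/
theorem rank_dual_eq_natCast_iff {V : Type*} [AddCommGroup V] [Module k V] (n : ℕ) :
    Module.rank k (Module.Dual k V) = n ↔ Module.rank k V = n := by
  have aux : Module.Finite k V → (Module.rank k (Module.Dual k V) = n ↔ Module.rank k V = n) := by
    intro _
    rw [← Module.finrank_eq_rank, Subspace.dual_finrank_eq, ← Module.finrank_eq_rank]
    simp only [Nat.cast_inj]
  constructor <;> intro h
  · have : Module.Finite k (Module.Dual k V) :=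
      Module.rank_lt_aleph0_iff.1 (h ▸ Cardinal.natCast_lt_aleph0)
    exact (aux ((Module.finite_dual_iff k).1 this)).1 h
  · exact (aux (Module.rank_lt_aleph0_iff.1 (h ▸ Cardinal.natCast_lt_aleph0))).2 h

theorem isSmoothBasisSet_iff_rank_tangentSpace (hβ : IsBasisSet β) :
    IsSmoothBasisSet k β ↔
      Module.rank k (tangentSpace k β) = ((r * β.card : ℕ) : Cardinal) := by
  rw [IsSmoothBasisSet, and_iff_right hβ, ← rank_dual_eq_natCast_iff,
    ← Cardinal.lift_inj, LinearEquiv.lift_rank_eq (dualCotangentEquiv k hβ)]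
  simp

end TangentSpace

/-! ### Exponents of a thickening and the splitting of its tangent space -/

section Thickening

variable {k : Type*} [Field k] {r : ℕ}

/-- The exponent vector of `x^d * x_{r+1}^s`. -/
noncomputable def snocExp (d : Fin r →₀ ℕ) (s : ℕ) : Fin (r + 1) →₀ ℕ :=
  Finsupp.embDomain Fin.castSuccEmb d + Finsupp.single (Fin.last r) s

@[simp]
theorem snocExp_castSucc (d : Fin r →₀ ℕ) (s : ℕ) (i : Fin r) :
    snocExp d s i.castSucc = d i := by
  have : Finsupp.embDomain Fin.castSuccEmb d i.castSucc = d i :=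
    Finsupp.embDomain_apply_self Fin.castSuccEmb d i
  rw [snocExp, Finsupp.add_apply, this, Finsupp.single_eq_of_ne (Fin.castSucc_lt_last i).ne,
    add_zero]

@[simp]
theorem snocExp_last (d : Fin r →₀ ℕ) (s : ℕ) : snocExp d s (Fin.last r) = s := by
  rw [snocExp, Finsupp.add_apply, Finsupp.embDomain_of_notMem_range, Finsupp.single_eq_same, zero_add]
  rintro ⟨i, hi⟩
  exact (Fin.castSucc_lt_last i).ne hi

/-- The exponents of the first `r` of `r + 1` variables. -/
noncomputable def initExp (e : Fin (r + 1) →₀ ℕ) : Fin r →₀ ℕ :=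
  Finsupp.equivFunOnFinite.symm fun i => e i.castSucc

@[simp]
theorem initExp_apply (e : Fin (r + 1) →₀ ℕ) (i : Fin r) : initExp e i = e i.castSucc := rfl

@[simp]
theorem initExp_snocExp (d : Fin r →₀ ℕ) (s : ℕ) : initExp (snocExp d s) = d := by
  ext i
  simp

theorem snocExp_initExp (e : Fin (r + 1) →₀ ℕ) : snocExp (initExp e) (e (Fin.last r)) = e := by
  ext i
  refine Fin.lastCases ?_ (fun i => ?_) i <;> simp

theorem snocExp_add_castSucc (d : Fin r →₀ ℕ) (s : ℕ) (i : Fin r) :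
    snocExp d s + Finsupp.single i.castSucc 1 = snocExp (d + Finsupp.single i 1) s := by
  ext l
  refine Fin.lastCases ?_ (fun l => ?_) l
  · simp [(Fin.castSucc_lt_last i).ne]
  · simp [Finsupp.single_apply]

theorem snocExp_add_last (d : Fin r →₀ ℕ) (s : ℕ) :
    snocExp d s + Finsupp.single (Fin.last r) 1 = snocExp d (s + 1) := by
  ext l
  refine Fin.lastCases ?_ (fun l => ?_) l
  · simp
  · simp

theorem mem_thickening {β₀ : Finset (Fin r →₀ ℕ)} {w : ℕ} {e : Fin (r + 1) →₀ ℕ} :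
    e ∈ thickening β₀ w ↔ initExp e ∈ β₀ ∧ e (Fin.last r) < w := by
  unfold thickening
  simp only [Finset.mem_image, Finset.mem_product, Finset.mem_range, Prod.exists]
  constructor
  · rintro ⟨d, s, ⟨hd, hs⟩, rfl⟩
    have := initExp_snocExp d s
    have := snocExp_last d s
    simp_all [snocExp]
  · rintro ⟨hd, hs⟩
    exact ⟨_, _, ⟨hd, hs⟩, snocExp_initExp e⟩

theorem snocExp_mem_thickening {β₀ : Finset (Fin r →₀ ℕ)} {w : ℕ} {d : Fin r →₀ ℕ} {s : ℕ} :
    snocExp d s ∈ thickening β₀ w ↔ d ∈ β₀ ∧ s < w := by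
  rw [mem_thickening, initExp_snocExp, snocExp_last]

theorem card_thickening (β₀ : Finset (Fin r →₀ ℕ)) (w : ℕ) :
    (thickening β₀ w).card = β₀.card * w := by
  unfold thickening
  rw [Finset.card_image_of_injective, Finset.card_product, Finset.card_range]
  rintro ⟨d, s⟩ ⟨d', s'⟩ h
  have h : snocExp d s = snocExp d' s' := h
  have h1 := congrArg initExp h
  have h2 := DFunLike.congr_fun h (Fin.last r)
  rw [initExp_snocExp, initExp_snocExp] at h1
  rw [snocExp_last, snocExp_last] at h2
  rw [h1, h2]

theorem IsBasisSet.thickening {β₀ : Finset (Fin r →₀ ℕ)} (hβ₀ : IsBasisSet β₀) {w : ℕ}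
    (hw : 0 < w) : IsBasisSet (thickening β₀ w) := by
  obtain ⟨d, hd⟩ := hβ₀.1
  refine ⟨⟨snocExp d 0, snocExp_mem_thickening.2 ⟨hd, hw⟩⟩, fun e he e' hle => ?_⟩
  rw [mem_thickening] at he ⊢
  exact ⟨hβ₀.2 _ he.1 _ fun i => hle i.castSucc, (hle _).trans_lt he.2⟩

variable {β₀ : Finset (Fin r →₀ ℕ)} {w : ℕ}

open Classical in
/-- The function on the arrows of the thickening assembled from functions `f u` on the arrows of
`β₀` (one for each power `x_{r+1}^u`) and from a function `h` on the heads of arrows with tail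
`x_{r+1}^w`. -/
noncomputable def thickeningFun (β₀ : Finset (Fin r →₀ ℕ)) (w : ℕ)
    (f : ℕ → (Fin r →₀ ℕ) → (Fin r →₀ ℕ) → k) (h : (Fin r →₀ ℕ) → ℕ → k)
    (d : Fin r →₀ ℕ) (s : ℕ) (j : Fin r →₀ ℕ) (t : ℕ) : k :=
  -- If `d ∈ β₀`, translation by `-(d, s - w)` brings the tail to `(0, w)` and the head to `(j - d,
  -- t + w - s)`. If `d ∉ β₀`, translation by `-(0, s)` brings the tail to `(d, 0)` and the head to
  -- `(j, t - s)`. The value is zero when the head would acquire a negative exponent.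
  if j ∈ β₀ ∧ t < w then
    if d ∈ β₀ then
      if w ≤ s ∧ s ≤ t + w ∧ d ≤ j then h (j - d) (t + w - s) else 0
    else if s ≤ t then f (t - s) d j else 0
  else 0

theorem thickeningFun_of_mem {f : ℕ → (Fin r →₀ ℕ) → (Fin r →₀ ℕ) → k}
    {h : (Fin r →₀ ℕ) → ℕ → k} {d : Fin r →₀ ℕ} {s : ℕ} {j : Fin r →₀ ℕ} {t : ℕ}
    (hj : j ∈ β₀ ∧ t < w) (hd : d ∈ β₀) (hs : w ≤ s) (ht : s ≤ t + w) (hle : d ≤ j) :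
    thickeningFun β₀ w f h d s j t = h (j - d) (t + w - s) := by
  rw [thickeningFun, if_pos hj, if_pos hd, if_pos ⟨hs, ht, hle⟩]

theorem thickeningFun_of_mem_of_not {f : ℕ → (Fin r →₀ ℕ) → (Fin r →₀ ℕ) → k}
    {h : (Fin r →₀ ℕ) → ℕ → k} {d : Fin r →₀ ℕ} {s : ℕ} {j : Fin r →₀ ℕ} {t : ℕ}
    (hd : d ∈ β₀) (hs : ¬(w ≤ s ∧ s ≤ t + w ∧ d ≤ j)) :
    thickeningFun β₀ w f h d s j t = 0 := by
  rw [thickeningFun, if_pos hd, if_neg hs, ite_self]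

theorem thickeningFun_of_notMem {f : ℕ → (Fin r →₀ ℕ) → (Fin r →₀ ℕ) → k}
    {h : (Fin r →₀ ℕ) → ℕ → k} {d : Fin r →₀ ℕ} {s : ℕ} {j : Fin r →₀ ℕ} {t : ℕ}
    (hj : j ∈ β₀ ∧ t < w) (hd : d ∉ β₀) (hs : s ≤ t) :
    thickeningFun β₀ w f h d s j t = f (t - s) d j := by
  rw [thickeningFun, if_pos hj, if_neg hd, if_pos hs]

theorem thickeningFun_of_notMem_of_lt {f : ℕ → (Fin r →₀ ℕ) → (Fin r →₀ ℕ) → k}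
    {h : (Fin r →₀ ℕ) → ℕ → k} {d : Fin r →₀ ℕ} {s : ℕ} {j : Fin r →₀ ℕ} {t : ℕ}
    (hd : d ∉ β₀) (hs : t < s) :
    thickeningFun β₀ w f h d s j t = 0 := by
  rw [thickeningFun, if_neg hd, if_neg (not_le.2 hs), ite_self]

/-- Both formulas respect translation; the delicate point is the passage between them, when a step
takes `d` out of `β₀`. -/
theorem thickeningFun_mem_tangentSpace (hβ₀ : IsBasisSet β₀)
    {f : ℕ → (Fin r →₀ ℕ) → (Fin r →₀ ℕ) → k} (hf : ∀ u, f u ∈ tangentSpace k β₀)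
    (h : (Fin r →₀ ℕ) → ℕ → k) :
    (fun e e' => thickeningFun β₀ w f h (initExp e) (e (Fin.last r)) (initExp e')
      (e' (Fin.last r))) ∈ tangentSpace k (thickening β₀ w) := by
  refine ⟨fun e e' he => ?_, fun e i e' he he' => ?_, fun e i e' he he' => ?_⟩
  · rw [mem_thickening, mem_thickening] at he
    dsimp only
    by_cases hj : initExp e' ∈ β₀ ∧ e' (Fin.last r) < w
    · have he := he.resolve_right (not_not_intro hj)
      exact thickeningFun_of_mem_of_not he.1 fun h' => by omega
    · exact if_neg hj
  · rw [← snocExp_initExp e] at he ⊢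
    rw [← snocExp_initExp e'] at he' ⊢
    generalize initExp e = d at *
    generalize e (Fin.last r) = s at *
    generalize initExp e' = j at *
    generalize e' (Fin.last r) = t at *
    rw [snocExp_mem_thickening] at he
    revert he'
    refine Fin.lastCases ?_ (fun i => ?_) i
    · simp only [snocExp_add_last, initExp_snocExp, snocExp_last, snocExp_mem_thickening]
      rintro ⟨hj, ht⟩
      by_cases hd : d ∈ β₀
      · have hs : w ≤ s := not_lt.1 fun hs => he ⟨hd, hs⟩
        by_cases hc : s ≤ t + w ∧ d ≤ j
        · rw [thickeningFun_of_mem ⟨hj, ht⟩ hd (by omega) (by omega) hc.2,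
            thickeningFun_of_mem ⟨hj, by omega⟩ hd hs hc.1 hc.2]
          congr 1
          omega
        · rw [thickeningFun_of_mem_of_not hd fun h' => hc ⟨by omega, h'.2.2⟩,
            thickeningFun_of_mem_of_not hd fun h' => hc h'.2]
      · rcases le_or_gt s t with hst | hst
        · rw [thickeningFun_of_notMem ⟨hj, ht⟩ hd (by omega),
            thickeningFun_of_notMem ⟨hj, by omega⟩ hd hst, Nat.add_sub_add_right]
        · rw [thickeningFun_of_notMem_of_lt hd (by omega), thickeningFun_of_notMem_of_lt hd hst]
    · simp only [snocExp_add_castSucc, initExp_snocExp, snocExp_last, snocExp_mem_thickening]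
      rintro ⟨hj, ht⟩
      have hj' : j ∈ β₀ := hβ₀.2 _ hj _ le_self_add
      by_cases hd : d ∈ β₀
      · have hs : w ≤ s := not_lt.1 fun hs => he ⟨hd, hs⟩
        by_cases hd' : d + Finsupp.single i 1 ∈ β₀
        · by_cases hc : s ≤ t + w ∧ d ≤ j
          · rw [thickeningFun_of_mem ⟨hj, ht⟩ hd' hs hc.1 (add_le_add_left hc.2 _),
              thickeningFun_of_mem ⟨hj', ht⟩ hd hs hc.1 hc.2, add_tsub_add_eq_tsub_right]
          · rw [thickeningFun_of_mem_of_not hd' fun h' => hc ⟨h'.2.1, le_of_add_le_add_right h'.2.2⟩,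
              thickeningFun_of_mem_of_not hd fun h' => hc h'.2]
        -- The step leaves `β₀`, and both values vanish: `t < w ≤ s` after it, and before it `d ≤ j`
        -- would put `d + e_i ≤ j + e_i` in `β₀`.
        · rw [thickeningFun_of_notMem_of_lt hd' (by omega), thickeningFun_of_mem_of_not hd]
          rintro ⟨-, -, hle⟩
          exact hd' (hβ₀.2 _ hj _ (add_le_add_left hle _))
      · have hd' : d + Finsupp.single i 1 ∉ β₀ := fun h' => hd (hβ₀.2 _ h' _ le_self_add)
        rcases le_or_gt s t with hst | hst
        · rw [thickeningFun_of_notMem ⟨hj, ht⟩ hd' hst, thickeningFun_of_notMem ⟨hj', ht⟩ hd hst,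
            (hf (t - s)).2.1 d i j hd hj]
        · rw [thickeningFun_of_notMem_of_lt hd' hst, thickeningFun_of_notMem_of_lt hd hst]
  · rw [← snocExp_initExp e] at he ⊢
    rw [← snocExp_initExp e'] at he' ⊢
    generalize initExp e = d at *
    generalize e (Fin.last r) = s at *
    generalize initExp e' = j at *
    generalize e' (Fin.last r) = t at *
    rw [snocExp_mem_thickening] at he
    revert he'
    refine Fin.lastCases ?_ (fun i => ?_) i
    · simp only [snocExp_add_last, initExp_snocExp, snocExp_last]
      rintro rfl
      by_cases hd : d ∈ β₀
      -- With head height `0`, a nonzero value needs `s + 1 = w`, but then the original tail lies in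
      -- the thickening.
      · exact thickeningFun_of_mem_of_not hd fun h' => he ⟨hd, by omega⟩
      · exact thickeningFun_of_notMem_of_lt hd (Nat.succ_pos s)
    · simp only [snocExp_add_castSucc, initExp_snocExp, snocExp_last, snocExp_castSucc]
      intro hi
      by_cases hd' : d + Finsupp.single i 1 ∈ β₀
      · refine thickeningFun_of_mem_of_not hd' fun h' => ?_
        have := h'.2.2 i
        simp [hi] at this
      · by_cases hj : j ∈ β₀ ∧ t < w
        swap
        · exact if_neg hj
        rcases le_or_gt s t with hst | hst
        · rw [thickeningFun_of_notMem hj hd' hst]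
          -- From `s ≤ t < w`, the tail can be outside the thickening only because `d ∉ β₀`.
          exact (hf (t - s)).2.2 d i j (fun hd => he ⟨hd, by omega⟩) hi
        · exact thickeningFun_of_notMem_of_lt hd' hst

theorem restrict_mem_tangentSpace (hβ₀ : IsBasisSet β₀)
    {F : (Fin (r + 1) →₀ ℕ) → (Fin (r + 1) →₀ ℕ) → k}
    (hF : F ∈ tangentSpace k (thickening β₀ w)) (u : Fin w) :
    (fun d j => if d ∈ β₀ then 0 else F (snocExp d 0) (snocExp j u))
      ∈ tangentSpace k β₀ := by
  have hmem : ∀ {d}, d ∉ β₀ → snocExp d 0 ∉ thickening β₀ w := fun h h' =>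
    h (snocExp_mem_thickening.1 h').1
  refine ⟨fun d j h => ?_, fun d i j hd hj => ?_, fun d i j hd hj => ?_⟩
  · dsimp only
    split_ifs with hd
    · rfl
    · exact hF.1 _ _ (Or.inr fun h' => h.resolve_left hd (snocExp_mem_thickening.1 h').1)
  · have hd' : d + Finsupp.single i 1 ∉ β₀ := fun h' => hd (hβ₀.2 _ h' _ le_self_add)
    dsimp only
    rw [if_neg hd, if_neg hd', ← snocExp_add_castSucc, ← snocExp_add_castSucc]
    refine hF.2.1 _ _ _ (hmem hd) ?_
    rw [snocExp_add_castSucc]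
    exact snocExp_mem_thickening.2 ⟨hj, u.2⟩
  · have hd' : d + Finsupp.single i 1 ∉ β₀ := fun h' => hd (hβ₀.2 _ h' _ le_self_add)
    dsimp only
    rw [if_neg hd', ← snocExp_add_castSucc]
    exact hF.2.2 _ _ _ (hmem hd) (by rw [snocExp_castSucc, hj])

/-- Translating backwards reduces every value either to one of the two families assumed to vanish or
to an arrow whose head can be pushed across a hyperplane. -/
theorem eq_zero_of_mem_tangentSpace_thickening
    {F : (Fin (r + 1) →₀ ℕ) → (Fin (r + 1) →₀ ℕ) → k}
    (hF : F ∈ tangentSpace k (thickening β₀ w))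
    (h₁ : ∀ d j, d ∉ β₀ → ∀ t, t < w → F (snocExp d 0) (snocExp j t) = 0)
    (h₂ : ∀ j, j ∈ β₀ → ∀ t, t < w → F (snocExp 0 w) (snocExp j t) = 0) : F = 0 := by
  obtain ⟨hF, hF', hF''⟩ := hF
  have hhead : ∀ {d s j t}, ¬(j ∈ β₀ ∧ t < w) → F (snocExp d s) (snocExp j t) = 0 := fun h =>
    hF _ _ (Or.inr fun h' => h (snocExp_mem_thickening.1 h'))
  -- At height `w` the tail is outside the thickening whatever `d` is, so `d` can be lowered all the
  -- way to `0`.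
  have hw : ∀ d j t, F (snocExp d w) (snocExp j t) = 0 := by
    intro d
    induction d using WellFoundedLT.induction with
    | ind d ih =>
    intro j t
    by_cases hj : j ∈ β₀ ∧ t < w
    swap
    · exact hhead hj
    by_cases hd : d = 0
    · rw [hd]
      exact h₂ j hj.1 t hj.2
    obtain ⟨i, hi⟩ := Finsupp.ne_iff.1 hd
    obtain ⟨d, rfl⟩ : ∃ d', d = d' + Finsupp.single i 1 := ⟨_, (tsub_add_cancel_of_le
      (Finsupp.single_le_iff.2 (Nat.one_le_iff_ne_zero.2 hi))).symm⟩
    have hmem : snocExp d w ∉ thickening β₀ w := fun h' =>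
      lt_irrefl _ (snocExp_mem_thickening.1 h').2
    by_cases hji : j i = 0
    · rw [← snocExp_add_castSucc]
      exact hF'' _ _ _ hmem (by rw [snocExp_castSucc, hji])
    · obtain ⟨j, rfl⟩ : ∃ j', j = j' + Finsupp.single i 1 := ⟨_, (tsub_add_cancel_of_le
        (Finsupp.single_le_iff.2 (Nat.one_le_iff_ne_zero.2 hji))).symm⟩
      have hlt : d < d + Finsupp.single i 1 :=
        lt_of_le_of_ne le_self_add fun e => by simpa using DFunLike.congr_fun e i
      rw [← snocExp_add_castSucc, ← snocExp_add_castSucc, hF' _ _ _ hmem]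
      · exact ih d hlt j t
      · rw [snocExp_add_castSucc]
        exact snocExp_mem_thickening.2 hj
  have hall : ∀ s d j t, ¬(d ∈ β₀ ∧ s < w) → F (snocExp d s) (snocExp j t) = 0 := by
    intro s
    induction s with
    | zero =>
      intro d j t h
      by_cases hj : j ∈ β₀ ∧ t < w
      · exact h₁ d j (fun hd => h ⟨hd, by omega⟩) t hj.2
      · exact hhead hj
    | succ s ih =>
      intro d j t h
      by_cases hds : d ∈ β₀ ∧ s < w
      -- Lowering the tail would take it into the thickening; this happens only from height exactly
      -- `w`, where `hw` applies.
      · obtain rfl : w = s + 1 := by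
          have := not_lt.1 fun h' => h ⟨hds.1, h'⟩
          omega
        exact hw d j t
      by_cases hj : j ∈ β₀ ∧ t < w
      swap
      · exact hhead hj
      have hmem : snocExp d s ∉ thickening β₀ w := fun h' => hds (snocExp_mem_thickening.1 h')
      cases t with
      | zero =>
        rw [← snocExp_add_last]
        exact hF'' _ _ _ hmem (snocExp_last j 0)
      | succ t =>
        rw [← snocExp_add_last, ← snocExp_add_last, hF' _ _ _ hmem]
        · exact ih d j t hds
        · rw [snocExp_add_last]
          exact snocExp_mem_thickening.2 hj
  funext e e'
  by_cases he : e ∈ thickening β₀ w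
  · exact hF e e' (Or.inl he)
  · rw [mem_thickening] at he
    have := hall _ _ (initExp e') (e' (Fin.last r)) he
    rwa [snocExp_initExp, snocExp_initExp] at this

/-- The tangent space of a thickening is the sum of `w` copies of the tangent space of `β₀` and of
a space with basis `β₀ × {0, ..., w - 1}`. -/
noncomputable def tangentSpaceThickeningEquiv (k : Type*) [Field k] (hβ₀ : IsBasisSet β₀) (w : ℕ) :
    tangentSpace k (thickening β₀ w) ≃ₗ[k]
      (Fin w → tangentSpace k β₀) × ({j : Fin r →₀ ℕ // j ∈ β₀} × Fin w → k) :=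
  LinearEquiv.ofBijective
    ({ toFun := fun F => (fun u => ⟨_, restrict_mem_tangentSpace hβ₀ F.2 u⟩,
          fun p => F.1 (snocExp 0 w) (snocExp p.1 p.2))
       map_add' := fun F G => by
        refine Prod.ext (funext fun u => Subtype.ext (funext fun d => funext fun j => ?_)) rfl
        change (if d ∈ β₀ then (0 : k) else _) = (if d ∈ β₀ then 0 else _) + (if d ∈ β₀ then 0 else _)
        split_ifs <;> simp
       map_smul' := fun c F => by
        refine Prod.ext (funext fun u => Subtype.ext (funext fun d => funext fun j => ?_)) rfl
        change (if d ∈ β₀ then (0 : k) else _) = c * (if d ∈ β₀ then 0 else _)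
        split_ifs <;> simp } :
      tangentSpace k (thickening β₀ w) →ₗ[k]
        (Fin w → tangentSpace k β₀) × ({j : Fin r →₀ ℕ // j ∈ β₀} × Fin w → k))
    ⟨by
      rw [← LinearMap.ker_eq_bot, LinearMap.ker_eq_bot']
      intro F hF
      refine Subtype.ext (eq_zero_of_mem_tangentSpace_thickening F.2 ?_ ?_)
      · intro d j hd t ht
        have := congrArg (fun p => (p.1 ⟨t, ht⟩).1 d j) hF
        exact (if_neg hd).symm.trans this
      · intro j hj t ht
        exact congrArg (fun p => p.2 (⟨j, hj⟩, ⟨t, ht⟩)) hF,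
    by
      rintro ⟨f, h⟩
      -- The given data are extended by zero to all heights and heads; the zero function is still a
      -- tangent vector.
      let f' : ℕ → (Fin r →₀ ℕ) → (Fin r →₀ ℕ) → k := fun u =>
        if hu : u < w then (f ⟨u, hu⟩).1 else 0
      have hf' : ∀ u, f' u ∈ tangentSpace k β₀ := by
        intro u
        dsimp only [f']
        split_ifs
        · exact (f _).2
        · exact Submodule.zero_mem _
      let h' : (Fin r →₀ ℕ) → ℕ → k := fun j t =>
        if hj : j ∈ β₀ ∧ t < w then h (⟨j, hj.1⟩, ⟨t, hj.2⟩) else 0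
      refine ⟨⟨_, thickeningFun_mem_tangentSpace (w := w) hβ₀ hf' h'⟩, ?_⟩
      refine Prod.ext (funext fun u => Subtype.ext (funext fun d => funext fun j => ?_))
        (funext fun p => ?_)
      · dsimp only [LinearMap.coe_mk, AddHom.coe_mk]
        rw [initExp_snocExp, initExp_snocExp, snocExp_last, snocExp_last]
        by_cases hd : d ∈ β₀
        · rw [if_pos hd, (f u).2.1 d j (Or.inl hd)]
        · rw [if_neg hd]
          by_cases hj : j ∈ β₀
          · rw [thickeningFun_of_notMem ⟨hj, u.2⟩ hd (Nat.zero_le _), Nat.sub_zero]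
            exact congrFun (congrFun (dif_pos u.2) d) j
          · rw [(f u).2.1 d j (Or.inr hj)]
            exact if_neg fun h' => hj h'.1
      · dsimp only [LinearMap.coe_mk, AddHom.coe_mk]
        have h0 : (0 : Fin r →₀ ℕ) ∈ β₀ := hβ₀.2 _ p.1.2 _ zero_le
        rw [initExp_snocExp, initExp_snocExp, snocExp_last, snocExp_last,
          thickeningFun_of_mem ⟨p.1.2, p.2.2⟩ h0 le_rfl (by omega) zero_le, tsub_zero,
          Nat.add_sub_cancel]
        exact dif_pos ⟨p.1.2, p.2.2⟩⟩

/-- The `w` copies of the tangent space of `β₀` contribute `w r |β₀|`, and the free scalars supply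
the `w |β₀|` required by the new variable. -/
theorem IsSmoothBasisSet.thickening (h : IsSmoothBasisSet k β₀) (hw : 0 < w) :
    IsSmoothBasisSet k (thickening β₀ w) := by
  have hβ₀ := h.1
  rw [isSmoothBasisSet_iff_rank_tangentSpace hβ₀] at h
  have hfin : Module.Finite k (tangentSpace k β₀) :=
    Module.rank_lt_aleph0_iff.1 (h ▸ Cardinal.natCast_lt_aleph0)
  rw [isSmoothBasisSet_iff_rank_tangentSpace (hβ₀.thickening hw),
    LinearEquiv.rank_eq (tangentSpaceThickeningEquiv k hβ₀ w), ← Module.finrank_eq_rank,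
    Module.finrank_prod, Module.finrank_pi_fintype, Module.finrank_fintype_fun_eq_card,
    card_thickening, Module.finrank_eq_of_rank_eq h, Nat.cast_inj]
  simp only [Finset.sum_const, Finset.card_univ, Fintype.card_fin, smul_eq_mul, Fintype.card_prod,
    Fintype.card_coe]
  ring

end Thickening

/-! ### Boxes as iterated thickenings -/

section Box

variable {k : Type*} [Field k]

theorem box_succ {r : ℕ} (w : Fin (r + 1) → ℕ) :
    box w = thickening (box fun i => w i.castSucc) (w (Fin.last r)) := by
  ext e
  rw [mem_thickening, mem_box, mem_box, Fin.forall_fin_succ']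
  rfl

/-- Base of the induction: the only monomial is `1` and it lies in `β`, so there are no arrows and
both dimensions are zero. -/
theorem isSmoothBasisSet_of_subsingleton {β : Finset (Fin 0 →₀ ℕ)} (hβ : IsBasisSet β) :
    IsSmoothBasisSet k β := by
  have hmem : ∀ d, d ∈ β := by
    obtain ⟨d, hd⟩ := hβ.1
    exact fun d' => Subsingleton.elim d d' ▸ hd
  have : Subsingleton (tangentSpace k β) :=
    ⟨fun F G => Subtype.ext (funext fun d => funext fun j => by
      rw [F.2.1 d j (Or.inl (hmem d)), G.2.1 d j (Or.inl (hmem d))])⟩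
  rw [isSmoothBasisSet_iff_rank_tangentSpace hβ, rank_subsingleton', zero_mul, Nat.cast_zero]

theorem isSmoothBasisSet_box (k : Type*) [Field k] :
    ∀ (r : ℕ) (w : Fin r → ℕ), (∀ i, 0 < w i) → IsSmoothBasisSet k (box w)
  | 0, w, _ => isSmoothBasisSet_of_subsingleton
      ⟨⟨0, (mem_box w 0).2 fun i => i.elim0⟩, fun _ _ m _ => (mem_box w m).2 fun i => i.elim0⟩
  | r + 1, w, hw => by
    rw [box_succ]
    exact (isSmoothBasisSet_box k r _ fun i => hw i.castSucc).thickening (hw (Fin.last r))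

end Box

end HilbertPoints

theorem mainTheorem9 (k : Type*) [Field k] [IsAlgClosed k] :
    (∀ (r : ℕ) (β₀ : Finset (Fin r →₀ ℕ)), HilbertPoints.IsSmoothBasisSet k β₀ →
      ∀ w : ℕ, 0 < w → HilbertPoints.IsSmoothBasisSet k (HilbertPoints.thickening β₀ w)) ∧
    (∀ (r : ℕ) (w : Fin r → ℕ), (∀ i, 0 < w i) →
      HilbertPoints.IsSmoothBasisSet k (HilbertPoints.box w)) := by
  exact ⟨fun _ _ h _ hw => h.thickening hw, HilbertPoints.isSmoothBasisSet_box k⟩
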